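/- Let $n\ge 0$, let $H^*(BT)=\mathbb Z[t_1,\dots,t_n]$ with each $t_i$ of degree $2$, and put $t_{-m}:=-t_m$ for $m\in[n]=\{1,\dots,n\}$. Let $\tilde S_n$ be the group of signed permutations, i.e. of the permutations $w$ of $\{\pm1,\dots,\pm n\}$ with $w(-a)=-w(a)$. The labeled graph $\mathcal C_n$ associated with the root system $\{\pm(t_i+t_j),\ \pm(t_i-t_j),\ \pm 2t_k \mid 1\le i<j\le n,\ 1\le k\le n\}$ of type $C_n$ has vertex set $\tilde S_n$; two vertices $w,w'$ are connected by an edge if and only if one of the following holds: (1) there is a pair $\{i,j\}\subset[n]$, $i\neq j$, with $(w'(i),w'(j))=\pm(w(j),w(i))$ and $w'(r)=w(r)$ for all $r\in[n]\setminus\{i,j\}$; the edge is then labeled by $t_{w(i)}-t_{w'(i)}$; (2) there is an $i\in[n]$ with $w'(i)=-w(i)$ and $w'(r)=w(r)$ for all $r\in[n]\setminus\{i\}$; the edge is then labeled by $2t_{w(i)}$. (Labels are determined up to sign, and the sign is irrelevant below.) The graph cohomology ring $H_T^*(\mathcal C_n)$ is the ring of all maps $h\colon\tilde S_n\to\mathbb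 Z[t_1,\dots,t_n]$ such that $h(w)-h(w')$ is divisible by the label of the edge between $w$ and $w'$ whenever $w$ and $w'$ are connected by an edge, graded by the grading of $\mathbb Z[t_1,\dots,t_n]$. It contains the elements $\tau_i$ and $t_i$ $(1\le i\le n)$ of degree $2$ given by $\tau_i(w)=t_{w(i)}$ and $t_i(w)=t_i$. **Theorem.** (a) For every $n$, sending the variables $\tau_i,t_i$ to the elements $\tau_i,t_i$ defines an isomorphism of graded $\mathbb Z[\tfrac12]$-algebras $$\mathbb Z[\tfrac12][\tau_1,\dots,\tau_n,t_1,\dots,t_n]\big/\big(e_i(\tau^2)-e_i(t^2)\mid i=1,\dots,n\big)\;\xrightarrow{\ \cong\ }\;H_T^*(\mathcal C_n)\otimes\mathbb Z[\tfrac12],$$ where $e_i(\tau^2)$ (resp. $e_i(t^2)$) is the $i$-th elementary symmetric polynomial in $\tau_1^2,\dots,\tau_n^2$ (resp. $t_1^2,\dots,t_n^2$). (b) The analogous statement over $\mathbb Z$ fails for $n=2$: there is an element $h\in H_T^*(\mathcal C_2)$ with $2h=(\tau_1-t_2)(\tau_2-t_2)(\tau_1-\tau_2+t_1+t_2)$,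 and $h$ is not a polynomial in $\tau_1,\tau_2,t_1,t_2$ with integer coefficients. In particular there is no ring isomorphism $\mathbb Z[\tau_1,\tau_2,t_1,t_2]/(e_i(\tau^2)-e_i(t^2)\mid i=1,2)\cong H_T^*(\mathcal C_2)$ that sends the variables $\tau_i,t_i$ to the elements $\tau_i,t_i$. -/

import Mathlib

open scoped TensorProduct

noncomputable section

/-- The cohomology ring `H^*(BT)` of the classifying space of a torus of rank `n`, identified with
the polynomial ring `ℤ[t_1, …, t_n]` by means of the basis `t_1, …, t_n` of `H^2(BT)`;
`H^{2k}(BT)` is the group of homogeneous polynomials of degree `k`. -/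
abbrev HBT (n : ℕ) : Type := MvPolynomial (Fin n) ℤ

/-- The group `H^2(BT)`. -/
abbrev H2BT (n : ℕ) : Type := MvPolynomial.homogeneousSubmodule (Fin n) ℤ 1

/-- A graph with vertex set `V` together with a label `ℓ(e) ∈ H^2(BT)` for each edge `e`. -/
structure LabeledGraph (V : Type*) (n : ℕ) where
  graph : SimpleGraph V
  label : graph.edgeSet → H2BT n

/-- The graph cohomology ring: the maps `h : V → H^*(BT)` for which `h(v) - h(v')` is divisible by
`ℓ(e)` whenever `v` and `v'` are connected by an edge `e`. -/
def graphCohomology {V : Type*} {n : ℕ} (Γ : LabeledGraph V n) : Subring (V → HBT n) where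
  carrier := {h | ∀ (v v' : V) (e : Γ.graph.Adj v v'),
    (Γ.label ⟨s(v, v'), e⟩ : HBT n) ∣ h v - h v'}
  mul_mem' := by
    intro a b ha hb v v' e
    have : (a * b) v - (a * b) v' = (a v - a v') * b v + a v' * (b v - b v') := by
      simp only [Pi.mul_apply]; ring
    rw [this]
    exact dvd_add ((ha v v' e).mul_right _) ((hb v v' e).mul_left _)
  add_mem' := by
    intro a b ha hb v v' e
    have : (a + b) v - (a + b) v' = (a v - a v') + (b v - b v') := by
      simp only [Pi.add_apply]; ring
    rw [this]
    exact dvd_add (ha v v' e) (hb v v' e)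
  one_mem' := by
    intro v v' _
    simp
  zero_mem' := by
    intro v v' _
    simp
  neg_mem' := by
    intro a ha v v' e
    have : (-a) v - (-a) v' = -(a v - a v') := by
      simp only [Pi.neg_apply]; ring
    rw [this]
    exact (ha v v' e).neg_right

/-- The part of degree `2k` of the graph cohomology ring, in the grading induced from that
of `H^*(BT)`. -/
def graphCohomologyDegree {V : Type*} {n : ℕ} (Γ : LabeledGraph V n) (k : ℕ) :
    Submodule ℤ (graphCohomology Γ) where
  carrier := {h | ∀ v : V, ((h : V → HBT n) v).IsHomogeneous k}
  zero_mem' := fun _ => MvPolynomial.isHomogeneous_zero _ _ _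
  add_mem' := fun ha hb v => (ha v).add (hb v)
  smul_mem' := fun c _ ha v =>
    (MvPolynomial.homogeneousSubmodule (Fin n) ℤ k).smul_mem c (ha v)

/-- The set `±[n] = {±1, …, ±n}`; the element `⟨i, ε⟩` stands for `ε i`. -/
@[ext]
structure SignedIndex (n : ℕ) where
  idx : Fin n
  sgn : ℤˣ

instance SignedIndex.instNeg (n : ℕ) : Neg (SignedIndex n) where
  neg a := ⟨a.idx, -a.sgn⟩

/-- The signed permutations: the permutations `w` of `±[n]` with `w(-a) = -w(a)`. -/
def SignedPerm (n : ℕ) : Type :=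
  {w : Equiv.Perm (SignedIndex n) // ∀ a, w (-a) = -w a}

/-- The value `w(i) ∈ ±[n]` of a signed permutation at `i ∈ [n]`. -/
def SignedPerm.val {n : ℕ} (w : SignedPerm n) (i : Fin n) : SignedIndex n := w.1 ⟨i, 1⟩

/-- The element `t_a ∈ H^2(BT)` for `a ∈ ±[n]`, where `t_{-m} = -t_m`. -/
def tSigned {n : ℕ} (a : SignedIndex n) : H2BT n :=
  (a.sgn : ℤ) • ⟨MvPolynomial.X a.idx, MvPolynomial.isHomogeneous_X ℤ a.idx⟩

theorem tSigned_neg {n : ℕ} (a : SignedIndex n) : tSigned (-a) = -tSigned a := by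
  show ((-a.sgn : ℤˣ) : ℤ) • _ = _
  rw [Units.val_neg, neg_smul]
  rfl

/-- `(w'(i), w'(j)) = ±(w(j), w(i))` and `w'(r) = w(r)` for all other `r ∈ [n]`. -/
def SwapEdge {n : ℕ} (w w' : SignedPerm n) (i j : Fin n) : Prop :=
  i ≠ j ∧
  ((w'.val i = w.val j ∧ w'.val j = w.val i) ∨ (w'.val i = -w.val j ∧ w'.val j = -w.val i)) ∧
  ∀ r, r ≠ i → r ≠ j → w'.val r = w.val r

/-- `w'(i) = -w(i)` and `w'(r) = w(r)` for all other `r ∈ [n]`. -/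
def NegEdge {n : ℕ} (w w' : SignedPerm n) (i : Fin n) : Prop :=
  w'.val i = -w.val i ∧ ∀ r, r ≠ i → w'.val r = w.val r

theorem SignedIndex.neg_neg' {n : ℕ} (a : SignedIndex n) : - -a = a := by
  ext
  · rfl
  · show ((- -a.sgn : ℤˣ) : ℤ) = a.sgn
    rw [neg_neg]

theorem SignedIndex.ne_neg {n : ℕ} (a : SignedIndex n) : a ≠ -a := by
  intro h
  have h1 : a.sgn = -a.sgn := congrArg SignedIndex.sgn h
  rcases Int.units_eq_one_or a.sgn with h2 | h2 <;> rw [h2] at h1 <;> exact absurd h1 (by decide)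

theorem SwapEdge.symm {n : ℕ} {w w' : SignedPerm n} {i j : Fin n} (h : SwapEdge w w' i j) :
    SwapEdge w' w i j := by
  obtain ⟨hij, h | h, hr⟩ := h
  · exact ⟨hij, Or.inl ⟨h.2.symm, h.1.symm⟩, fun r h1 h2 => (hr r h1 h2).symm⟩
  · refine ⟨hij, Or.inr ⟨?_, ?_⟩, fun r h1 h2 => (hr r h1 h2).symm⟩
    · rw [h.2, SignedIndex.neg_neg']
    · rw [h.1, SignedIndex.neg_neg']

theorem NegEdge.symm {n : ℕ} {w w' : SignedPerm n} {i : Fin n} (h : NegEdge w w' i) :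
    NegEdge w' w i :=
  ⟨by rw [h.1, SignedIndex.neg_neg'], fun r h1 => (h.2 r h1).symm⟩

theorem SignedPerm.val_inj {n : ℕ} (w : SignedPerm n) {i j : Fin n}
    (h : w.val i = w.val j) : i = j :=
  congrArg SignedIndex.idx (w.1.injective h)

theorem SignedPerm.val_ne_neg {n : ℕ} (w : SignedPerm n) (i j : Fin n) :
    w.val i ≠ -w.val j := by
  intro h
  have h1 : w.1 ⟨i, 1⟩ = w.1 (-⟨j, 1⟩) := by rw [w.2]; exact h
  have h2 : (1 : ℤˣ) = -1 := congrArg SignedIndex.sgn (w.1.injective h1)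
  exact absurd h2 (by decide)

theorem SwapEdge.ne {n : ℕ} {w w' : SignedPerm n} {i j : Fin n} (h : SwapEdge w w' i j) :
    w ≠ w' := by
  rintro rfl
  obtain ⟨hij, h | h, -⟩ := h
  · exact hij (w.val_inj h.1)
  · exact w.val_ne_neg i j h.1

theorem NegEdge.ne {n : ℕ} {w w' : SignedPerm n} {i : Fin n} (h : NegEdge w w' i) :
    w ≠ w' := by
  rintro rfl
  exact w.val_ne_neg i i h.1

/-- The underlying graph of the labeled graph of type `C_n`. -/
def graphC (n : ℕ) : SimpleGraph (SignedPerm n) where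
  Adj w w' := (∃ i j, SwapEdge w w' i j) ∨ ∃ i, NegEdge w w' i
  symm := ⟨by
    rintro w w' (⟨i, j, h⟩ | ⟨i, h⟩)
    · exact Or.inl ⟨i, j, h.symm⟩
    · exact Or.inr ⟨i, h.symm⟩⟩
  loopless := ⟨by
    rintro w (⟨i, j, h⟩ | ⟨i, h⟩)
    · exact h.ne rfl
    · exact h.ne rfl⟩

/-- `ℓ` is a label of the edge from `w` to `w'`: it is `t_{w(i)} - t_{w'(i)}` if the edge arises
from a pair `{i, j}`, and `2 t_{w(i)}` if it arises from a sign change at `i`. -/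
def IsLabelC {n : ℕ} (w w' : SignedPerm n) (ℓ : H2BT n) : Prop :=
  (∃ i j, SwapEdge w w' i j ∧ ℓ = tSigned (w.val i) - tSigned (w'.val i)) ∨
  ∃ i, NegEdge w w' i ∧ ℓ = (2 : ℤ) • tSigned (w.val i)

theorem exists_labelC {n : ℕ} (e : (graphC n).edgeSet) :
    ∃ ℓ : H2BT n, ∃ w w' : SignedPerm n, s(w, w') = e.1 ∧ IsLabelC w w' ℓ := by
  obtain ⟨e, he⟩ := e
  induction e using Sym2.ind with
  | _ w w' =>
    rcases he with ⟨i, j, h⟩ | ⟨i, h⟩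
    · exact ⟨_, w, w', rfl, Or.inl ⟨i, j, h, rfl⟩⟩
    · exact ⟨_, w, w', rfl, Or.inr ⟨i, h, rfl⟩⟩

/-- The labeled graph `C_n` associated with the root system
`{±(t_i + t_j), ±(t_i - t_j), ±2 t_k}` of type `C_n`. The prescription for the label of an
edge determines it up to sign, see `labelC_unique`; a sign is chosen here. -/
def typeC (n : ℕ) : LabeledGraph (SignedPerm n) n where
  graph := graphC n
  label e := (exists_labelC e).choose

theorem IsLabelC.eq_sub {n : ℕ} {w w' : SignedPerm n} {ℓ : H2BT n} (h : IsLabelC w w' ℓ) :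
    ∃ i, w'.val i ≠ w.val i ∧ ℓ = tSigned (w.val i) - tSigned (w'.val i) := by
  rcases h with ⟨i, j, h, hl⟩ | ⟨i, h, hl⟩
  · refine ⟨i, fun hi => ?_, hl⟩
    obtain ⟨hij, h1 | h1, -⟩ := h
    · exact hij (w.val_inj (hi.symm.trans h1.1))
    · exact w.val_ne_neg i j (hi.symm.trans h1.1)
  · refine ⟨i, fun hi => (SignedIndex.ne_neg (w.val i)) (hi.symm.trans h.1), ?_⟩
    rw [hl, h.1, tSigned_neg, sub_neg_eq_add, two_smul]

theorem graphC_sub_eq {n : ℕ} {w w' : SignedPerm n} (e : (graphC n).Adj w w') {i j : Fin n}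
    (hi : w'.val i ≠ w.val i) (hj : w'.val j ≠ w.val j) :
    tSigned (w.val i) - tSigned (w'.val i) = tSigned (w.val j) - tSigned (w'.val j) ∨
    tSigned (w.val i) - tSigned (w'.val i) = -(tSigned (w.val j) - tSigned (w'.val j)) := by
  rcases e with ⟨a, b, -, h, hr⟩ | ⟨a, h⟩
  · have hi' : i = a ∨ i = b := by
      by_contra hc
      exact hi (hr i (fun h => hc (Or.inl h)) (fun h => hc (Or.inr h)))
    have hj' : j = a ∨ j = b := by
      by_contra hc
      exact hj (hr j (fun h => hc (Or.inl h)) (fun h => hc (Or.inr h)))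
    rcases h with h | h <;> rcases hi' with rfl | rfl <;> rcases hj' with rfl | rfl <;>
      simp only [h.1, h.2, tSigned_neg, true_or] <;>
      first
        | (left; abel1)
        | (right; abel1)
  · have hi' : i = a := by
      by_contra hc
      exact hi (h.2 i hc)
    have hj' : j = a := by
      by_contra hc
      exact hj (h.2 j hc)
    rw [hi', hj']
    exact Or.inl rfl

theorem labelC_eq {n : ℕ} {w w' : SignedPerm n} (e : (graphC n).Adj w w') {i : Fin n}
    (hi : w'.val i ≠ w.val i) :
    (typeC n).label ⟨s(w, w'), e⟩ = tSigned (w.val i) - tSigned (w'.val i) ∨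
    (typeC n).label ⟨s(w, w'), e⟩ = -(tSigned (w.val i) - tSigned (w'.val i)) := by
  obtain ⟨v, v', hv, hl⟩ := (exists_labelC ⟨s(w, w'), e⟩).choose_spec
  change (exists_labelC ⟨s(w, w'), e⟩).choose = _ ∨ (exists_labelC ⟨s(w, w'), e⟩).choose = _
  generalize (exists_labelC ⟨s(w, w'), e⟩).choose = m at hl
  obtain ⟨j, hj, rfl⟩ := hl.eq_sub
  rcases Sym2.eq_iff.1 hv with ⟨rfl, rfl⟩ | ⟨rfl, rfl⟩
  · exact graphC_sub_eq e hj hi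
  · rw [← neg_sub (tSigned (v'.val j))]
    rcases graphC_sub_eq e hj.symm hi with h | h
    · exact Or.inr (by rw [h])
    · exact Or.inl (by rw [h, neg_neg])

/-- The label of an edge of `C_n` does not depend, up to sign, on the order of its end points and
on the indices used to describe it. -/
theorem labelC_unique {n : ℕ} {w w' : SignedPerm n} (e : (graphC n).Adj w w') {ℓ : H2BT n}
    (h : IsLabelC w w' ℓ) :
    (typeC n).label ⟨s(w, w'), e⟩ = ℓ ∨ (typeC n).label ⟨s(w, w'), e⟩ = -ℓ := by
  obtain ⟨i, hi, rfl⟩ := h.eq_sub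
  exact labelC_eq e hi

/-- The class `τ_i`, with `τ_i(w) = t_{w(i)}`. -/
def tauC (n : ℕ) (i : Fin n) : graphCohomology (typeC n) :=
  ⟨fun w => (tSigned (w.val i) : HBT n), by
    intro w w' e
    show _ ∣ (tSigned (w.val i) : HBT n) - (tSigned (w'.val i) : HBT n)
    by_cases hi : w'.val i = w.val i
    · rw [hi, sub_self]
      exact dvd_zero _
    · rcases labelC_eq e hi with h | h
      · exact dvd_of_eq (by rw [h]; rfl)
      · exact (neg_dvd).1 (dvd_of_eq (by rw [h]; simp))⟩

/-- The class `t_i`, with `t_i(w) = t_i`. -/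
def tC (n : ℕ) (i : Fin n) : graphCohomology (typeC n) :=
  ⟨fun _ => MvPolynomial.X i, by intro w w' _; simp⟩

/-- The ideal of `R[τ_1, …, τ_n, t_1, …, t_n]` generated by `e_i(τ^2) - e_i(t^2)`, `i = 1, …, n`,
where `e_i` is the `i`-th elementary symmetric polynomial; the variables `τ_i` and `t_i` are
`X (Sum.inl i)` and `X (Sum.inr i)`. -/
def idealC (n : ℕ) (R : Type) [CommRing R] : Ideal (MvPolynomial (Fin n ⊕ Fin n) R) :=
  Ideal.span {p | ∃ i : ℕ, 1 ≤ i ∧ i ≤ n ∧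
    p = MvPolynomial.aeval (fun j => MvPolynomial.X (Sum.inl j) ^ 2) (MvPolynomial.esymm (Fin n) R i)
      - MvPolynomial.aeval (fun j => MvPolynomial.X (Sum.inr j) ^ 2) (MvPolynomial.esymm (Fin n) R i)}

/-- The ring `R[τ_1, …, τ_n, t_1, …, t_n] / (e_i(τ^2) - e_i(t^2) | i = 1, …, n)`. -/
abbrev RingC (n : ℕ) (R : Type) [CommRing R] : Type :=
  MvPolynomial (Fin n ⊕ Fin n) R ⧸ idealC n R

/-- The classes of polynomials of degree `k`: the part of degree `2k` of `RingC n R`, where the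
variables have degree `2`. -/
def ringCDegree (n : ℕ) (R : Type) [CommRing R] (k : ℕ) : Submodule R (RingC n R) :=
  (MvPolynomial.homogeneousSubmodule (Fin n ⊕ Fin n) R k).map
    (Ideal.Quotient.mkₐ R (idealC n R)).toLinearMap

/-- The ring `ℤ[1/2]`. -/
def ZHalf : Type := Localization.Away (2 : ℤ)

instance ZHalf.instCommRing : CommRing ZHalf :=
  inferInstanceAs (CommRing (Localization.Away (2 : ℤ)))

theorem ZHalf.isLocalization : IsLocalization.Away (2 : ℤ) ZHalf := by
  have h : (OreLocalization.instAlgebra : Algebra ℤ (Localization.Away (2 : ℤ))) =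
      (Ring.toIntAlgebra ZHalf : Algebra ℤ ZHalf) := Subsingleton.elim _ _
  have h2 : IsLocalization.Away (2 : ℤ) (Localization.Away (2 : ℤ)) := inferInstance
  exact h ▸ h2

end

noncomputable section

variable {n : ℕ}

/-! Evaluate a polynomial in `τ`, `t` at `w` by `τ_i ↦ t_{w(i)}`. The claim is that these
evaluations have common kernel `idealC` and, once 2 is a unit, produce every function obeying the
edge conditions. Both halves are Newton interpolation in one `τ_i`, by induction on a set `G` of
free positions: only the `w` agreeing with a fixed `v` outside `G` are considered, and fixing `w(i)`
for one `i ∈ G` leaves a smaller problem of the same kind.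

Surjectivity (`exists_evalAt_eq_of_agreeOff`): suppose the error vanishes wherever `w(i)` lies in a
set of values. On the layer `w(i) = a`, for a new value `a`, the edges force divisibility by `t_a -
t_b` for each old `b`. With 2 inverted these are pairwise non-associated primes, so their product
divides the error, and the quotient obeys the edge conditions on the layer.

Injectivity (`mem_relIdeal_of_evalAt_eq_zero`): a vanishing polynomial is divided by the factors
`τ_i - t_a` one at a time, modulo the relations, until the product of all of them appears, which is
itself a relation (`prod_X_sub_mem_relIdeal`). Only `2 ≠ 0` is needed, so `mem_idealC_iff` also
holds over `ℤ`.

For (b), all values of the given product `P` are divisible by 4. Writing `P = 4f`, the function `2f`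
still obeys the edge conditions. If `2f` were a polynomial `g`, then `2g - P ∈ idealC`; but modulo 2
and `t = 0` the relations hold in `F_2[x,ε]/(ε²,x⁴)` under `τ_1 ↦ x`, `τ_2 ↦ x + ε`, where `P`
becomes `x²ε ≠ 0`. -/

theorem SignedIndex.neg_idx (a : SignedIndex n) : (-a).idx = a.idx := rfl

theorem SignedIndex.eq_or_eq_neg {a b : SignedIndex n} (h : a.idx = b.idx) : a = b ∨ a = -b := by
  rcases Int.units_eq_one_or a.sgn with h1 | h1 <;> rcases Int.units_eq_one_or b.sgn with h2 | h2
  · exact Or.inl (SignedIndex.ext h (by rw [h1, h2]))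
  · exact Or.inr (SignedIndex.ext h (by show _ = ((-b.sgn : ℤˣ)); simp [h1, h2]))
  · exact Or.inr (SignedIndex.ext h (by show _ = ((-b.sgn : ℤˣ)); simp [h1, h2]))
  · exact Or.inl (SignedIndex.ext h (by rw [h1, h2]))

theorem SignedPerm.ext_val {w w' : SignedPerm n} (h : ∀ i, w.val i = w'.val i) : w = w' := by
  apply Subtype.ext
  apply Equiv.ext
  intro p
  rcases SignedIndex.eq_or_eq_neg (a := p) (b := ⟨p.idx, 1⟩) rfl with hp | hp
  · rw [hp]; exact h _
  · rw [hp, w.2, w'.2]; exact congrArg _ (h _)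

instance SignedIndex.instFinite : Finite (SignedIndex n) :=
  Finite.of_injective (fun a : SignedIndex n => (a.idx, a.sgn))
    (fun _ _ h => SignedIndex.ext (congrArg Prod.fst h) (congrArg Prod.snd h))

/-- Two signed permutations that agree at a position agree at its negative. -/
theorem SignedPerm.apply_congr {w w' : SignedPerm n} {p : SignedIndex n}
    (h : w.val p.idx = w'.val p.idx) : w.1 p = w'.1 p := by
  rcases SignedIndex.eq_or_eq_neg (a := p) (b := ⟨p.idx, 1⟩) rfl with hp | hp
  · rw [hp]; exact h
  · rw [hp, w.2, w'.2]; exact congrArg _ h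

/-! ### Reflections and neighbours with a prescribed value. -/

open Classical in
/-- The reflection that exchanges `a` with `b` and `-a` with `-b`. -/
def signedSwapFun (a b x : SignedIndex n) : SignedIndex n :=
  if x = a then b else if x = b then a else if x = -a then -b else if x = -b then -a else x

theorem signedSwapFun_involutive (a b : SignedIndex n) :
    Function.Involutive (signedSwapFun a b) := by
  intro x
  have h1 := @SignedIndex.neg_neg' n
  have h2 := @SignedIndex.ne_neg n
  unfold signedSwapFun
  grind

theorem signedSwapFun_neg (a b x : SignedIndex n) :
    signedSwapFun a b (-x) = -signedSwapFun a b x := by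
  have h1 := @SignedIndex.neg_neg' n
  have h2 := @SignedIndex.ne_neg n
  unfold signedSwapFun
  grind

/-- The signed permutation `w` followed, on positions, by the exchange of `a` and `b`. -/
def SignedPerm.mulSwap (w : SignedPerm n) (a b : SignedIndex n) : SignedPerm n :=
  ⟨(signedSwapFun_involutive a b).toPerm.trans w.1, fun x => by
    simp [signedSwapFun_neg, w.2]⟩

theorem SignedPerm.mulSwap_val (w : SignedPerm n) (a b : SignedIndex n) (i : Fin n) :
    (w.mulSwap a b).val i = w.1 (signedSwapFun a b ⟨i, 1⟩) := rfl

/-- Every vertex has a neighbour at which the value at `i` is any other prescribed value. -/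
theorem exists_adj_val_eq (w : SignedPerm n) (i : Fin n) {p : SignedIndex n} (hp : p ≠ ⟨i, 1⟩) :
    ∃ w' : SignedPerm n, w'.val i = w.1 p ∧ (graphC n).Adj w w' ∧
      ∀ r, r ≠ i → r ≠ p.idx → w'.val r = w.val r := by
  have hi : (w.mulSwap ⟨i, 1⟩ p).val i = w.1 p := by
    rw [SignedPerm.mulSwap_val]; simp [signedSwapFun]
  have hr : ∀ r, r ≠ i → r ≠ p.idx → (w.mulSwap ⟨i, 1⟩ p).val r = w.val r := by
    intro r h1 h2
    rw [SignedPerm.mulSwap_val]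
    have e1 : (⟨r, 1⟩ : SignedIndex n) ≠ ⟨i, 1⟩ := fun h => h1 (congrArg SignedIndex.idx h)
    have e2 : (⟨r, 1⟩ : SignedIndex n) ≠ p := fun h => h2 (congrArg SignedIndex.idx h)
    have e3 : (⟨r, 1⟩ : SignedIndex n) ≠ -⟨i, 1⟩ := fun h => h1 (congrArg SignedIndex.idx h)
    have e4 : (⟨r, 1⟩ : SignedIndex n) ≠ -p := fun h => h2 (congrArg SignedIndex.idx h)
    simp [signedSwapFun, e1, e2, e3, e4, SignedPerm.val]
  refine ⟨_, hi, ?_, hr⟩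
  -- For `p = -i` the reflection is a sign change at `i`; otherwise it is a swap, and the sign of
  -- `p` selects the sign in the swap condition.
  by_cases hpi : p.idx = i
  · right
    refine ⟨i, ?_, fun r h => hr r h (hpi ▸ h)⟩
    rcases SignedIndex.eq_or_eq_neg (a := p) (b := ⟨i, 1⟩) hpi with h | h
    · exact absurd h hp
    · rw [hi, h, w.2]; rfl
  · left
    refine ⟨i, p.idx, Ne.symm hpi, ?_, hr⟩
    have e1 : (⟨p.idx, 1⟩ : SignedIndex n) ≠ ⟨i, 1⟩ := fun h => hpi (congrArg SignedIndex.idx h)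
    have e3 : (⟨p.idx, 1⟩ : SignedIndex n) ≠ -⟨i, 1⟩ := fun h => hpi (congrArg SignedIndex.idx h)
    rcases SignedIndex.eq_or_eq_neg (a := ⟨p.idx, 1⟩) (b := p) rfl with h | h
    · left
      refine ⟨by rw [hi, SignedPerm.val, h], ?_⟩
      rw [SignedPerm.mulSwap_val]
      simp [signedSwapFun, h, SignedPerm.val]
    · right
      refine ⟨by rw [hi, SignedPerm.val, h, w.2, SignedIndex.neg_neg'], ?_⟩
      rw [SignedPerm.mulSwap_val]
      have e2 : (⟨p.idx, 1⟩ : SignedIndex n) ≠ p := fun h' =>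
        SignedIndex.ne_neg p (h'.symm.trans h)
      simp only [signedSwapFun, SignedPerm.val, ← w.2]
      rw [if_neg e1, if_neg e2, if_neg e3, if_pos h]

/-! ### Signed permutations that are free only on `G`. -/

/-- `w` agrees with `v` at all positions outside `G`. -/
def AgreeOff (G : Finset (Fin n)) (v w : SignedPerm n) : Prop :=
  ∀ i, i ∉ G → w.val i = v.val i

theorem AgreeOff.refl (G : Finset (Fin n)) (v : SignedPerm n) : AgreeOff G v v := fun _ _ => rfl

theorem AgreeOff.mem_of_apply_eq {G : Finset (Fin n)} {v w : SignedPerm n} (h : AgreeOff G v w)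
    {p q : SignedIndex n} (hpq : w.1 q = v.1 p) (hq : q.idx ∈ G) : p.idx ∈ G := by
  by_contra hp
  have := w.1.injective (hpq.trans (SignedPerm.apply_congr (h _ hp)).symm)
  exact hp (this ▸ hq)

theorem AgreeOff.of_insert {G : Finset (Fin n)} {i : Fin n} {v v' w : SignedPerm n}
    (hv : AgreeOff (insert i G) v v') (hw : AgreeOff G v' w) : AgreeOff (insert i G) v w :=
  fun j hj => (hw j fun h => hj (Finset.mem_insert_of_mem h)).trans (hv j hj)

theorem AgreeOff.of_insert_of_val_eq {G : Finset (Fin n)} {i : Fin n} {v v' w : SignedPerm n}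
    (hv : AgreeOff (insert i G) v v') (hw : AgreeOff (insert i G) v w)
    (hi : w.val i = v'.val i) : AgreeOff G v' w := by
  intro j hj
  by_cases h : j = i
  · rw [h, hi]
  · have : j ∉ insert i G := by simp [h, hj]
    rw [hv j this, hw j this]

/-- A neighbour with prescribed value at `i`, inside the set of signed permutations agreeing with
`v` outside `G`. -/
theorem AgreeOff.exists_adj {G : Finset (Fin n)} {v w : SignedPerm n} (hw : AgreeOff G v w)
    {i : Fin n} (hi : i ∈ G) {p : SignedIndex n} (hp : p.idx ∈ G) (hne : w.val i ≠ v.1 p) :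
    ∃ w', AgreeOff G v w' ∧ w'.val i = v.1 p ∧ (graphC n).Adj w w' := by
  -- The position where `w` takes the value `v(p)`; it lies over `G` because `v` and `w` coincide
  -- elsewhere.
  set q := w.1.symm (v.1 p) with hq
  have hwq : w.1 q = v.1 p := by simp [hq]
  have hqG : q.idx ∈ G := by
    by_contra h
    have h1 : w.1 q = v.1 q := SignedPerm.apply_congr (hw _ h)
    exact h (v.1.injective (hwq.symm.trans h1) ▸ hp)
  obtain ⟨w', h1, h2, h3⟩ := exists_adj_val_eq w i (p := q) (by
    intro h; apply hne; rw [← hwq, h]; rfl)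
  refine ⟨w', fun r hr => ?_, h1.trans hwq, h2⟩
  rw [h3 r (fun h => hr (h ▸ hi)) (fun h => hr (h ▸ hqG)), hw r hr]

theorem AgreeOff.exists_val_eq (G : Finset (Fin n)) (v : SignedPerm n)
    {i : Fin n} (hi : i ∈ G) {p : SignedIndex n} (hp : p.idx ∈ G) :
    ∃ w', AgreeOff G v w' ∧ w'.val i = v.1 p := by
  by_cases h : v.val i = v.1 p
  · exact ⟨v, AgreeOff.refl G v, h⟩
  · obtain ⟨w', h1, h2, -⟩ := (AgreeOff.refl G v).exists_adj hi hp h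
    exact ⟨w', h1, h2⟩

/-! ### Primality and coprimality of the linear forms `t_a - t_b`. -/

section Linear

variable (R : Type) [CommRing R]

/-- The linear form `t_a`, `a ∈ ±[n]`, over an arbitrary coefficient ring. -/
def tPoly (a : SignedIndex n) : MvPolynomial (Fin n) R :=
  MvPolynomial.C ((a.sgn : ℤ) : R) * MvPolynomial.X a.idx

theorem tPoly_neg (a : SignedIndex n) : tPoly R (-a) = -tPoly R a := by
  have h1 : (-a).sgn = -a.sgn := rfl
  have h2 : (-a).idx = a.idx := rfl
  simp [tPoly, h1, h2]

theorem tPoly_one (i : Fin n) : tPoly R ⟨i, 1⟩ = MvPolynomial.X i := by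
  simp [tPoly]

theorem tPoly_sq (a : SignedIndex n) : tPoly R a ^ 2 = MvPolynomial.X a.idx ^ 2 := by
  rcases Int.units_eq_one_or a.sgn with h | h <;> simp [tPoly, h]

theorem tPoly_isHomogeneous (a : SignedIndex n) : (tPoly R a).IsHomogeneous 1 := by
  simpa [tPoly] using (MvPolynomial.isHomogeneous_C (Fin n) ((a.sgn : ℤ) : R)).mul
    (MvPolynomial.isHomogeneous_X R a.idx)

theorem map_tSigned (a : SignedIndex n) :
    MvPolynomial.map (Int.castRingHom R) (tSigned a : HBT n) = tPoly R a := by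
  rcases Int.units_eq_one_or a.sgn with h | h <;> simp [tPoly, tSigned, h]

theorem tSigned_eq_tPoly (a : SignedIndex n) : (tSigned a : HBT n) = tPoly ℤ a := by
  rcases Int.units_eq_one_or a.sgn with h | h <;> simp [tPoly, tSigned, h]

theorem eval_tPoly (x : Fin n → R) (a : SignedIndex n) :
    MvPolynomial.eval x (tPoly R a) = ((a.sgn : ℤ) : R) * x a.idx := by
  simp [tPoly]

variable {R}

theorem MvPolynomial.X_sub_dvd_sub_aeval {σ : Type*} [DecidableEq σ] (i : σ)
    (r f : MvPolynomial σ R) : (X i - r) ∣ f - aeval (Function.update X i r) f := by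
  rw [← Ideal.mem_span_singleton, ← Ideal.Quotient.eq]
  have : (Ideal.Quotient.mkₐ R (Ideal.span {X i - r})).comp (aeval (Function.update X i r)) =
      Ideal.Quotient.mkₐ R (Ideal.span {X i - r}) := by
    ext j
    by_cases h : j = i
    · subst h
      simpa using (Ideal.Quotient.eq.2 (Ideal.mem_span_singleton_self _)).symm
    · simp [h]
  exact (DFunLike.congr_fun this f).symm

/-- Since `r` is fixed by the substitution `X i ↦ r`, the kernel of that endomorphism is generated
by `X i - r`, and its target is a domain. -/
theorem MvPolynomial.prime_X_sub_of_aeval_eq {σ : Type*} [DecidableEq σ] [IsDomain R] (i : σ)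
    {r : MvPolynomial σ R} (hr : aeval (Function.update X i r) r = r) (hne : X i - r ≠ 0) :
    Prime (X i - r) := by
  have key : ∀ f, (X i - r) ∣ f ↔ aeval (Function.update X i r) f = 0 := by
    intro f
    constructor
    · rintro ⟨q, rfl⟩
      rw [map_mul, map_sub, hr, aeval_X, Function.update_self, sub_self, zero_mul]
    · intro h
      have := X_sub_dvd_sub_aeval i r f
      rwa [h, sub_zero] at this
  refine ⟨hne, fun hu => ?_, fun f g h => ?_⟩
  · have := (key 1).1 (hu.dvd)
    simp at this
  · rw [key, map_mul, mul_eq_zero] at h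
    rwa [key, key]

theorem MvPolynomial.prime_X_of_isDomain {σ : Type*} [IsDomain R] (i : σ) :
    Prime (X i : MvPolynomial σ R) := by
  classical
  simpa using prime_X_sub_of_aeval_eq (R := R) i (r := 0) (by simp) (by simp)

theorem prime_tPoly [IsDomain R] (a : SignedIndex n) : Prime (tPoly R a) := by
  have := MvPolynomial.prime_X_of_isDomain (R := R) a.idx
  rcases Int.units_eq_one_or a.sgn with h | h
  · simpa [tPoly, h]
  · simpa [tPoly, h] using this.neg

theorem prime_tPoly_sub_of_idx_ne [IsDomain R] {a b : SignedIndex n} (h : a.idx ≠ b.idx) :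
    Prime (tPoly R a - tPoly R b) := by
  have key : ∀ (i : Fin n) (c : SignedIndex n), i ≠ c.idx →
      Prime (MvPolynomial.X i - tPoly R c) := by
    intro i c hc
    refine MvPolynomial.prime_X_sub_of_aeval_eq i ?_ ?_
    · simp [tPoly, Ne.symm hc]
    · intro h0
      have := congrArg (MvPolynomial.eval (Function.update (0 : Fin n → R) i 1)) h0
      simp [eval_tPoly, Ne.symm hc] at this
  rcases SignedIndex.eq_or_eq_neg (a := a) (b := ⟨a.idx, 1⟩) rfl with ha | ha
  · rw [ha, tPoly_one]
    exact key _ _ h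
  · rw [ha, tPoly_neg, tPoly_one]
    have := (key a.idx (-b) h).neg
    rwa [tPoly_neg, sub_neg_eq_add, neg_add, ← sub_eq_add_neg] at this

theorem tPoly_sub_eq_two_mul {a b : SignedIndex n} (h : a.idx = b.idx) (hne : a ≠ b) :
    tPoly R a - tPoly R b = 2 * tPoly R a := by
  rcases SignedIndex.eq_or_eq_neg h.symm with hb | hb
  · exact absurd hb.symm hne
  · rw [hb, tPoly_neg]; ring

/-- For `b = -a` the form is `2 t_a`, which is prime only because 2 is a unit: this is where
surjectivity needs `1/2`. -/
theorem prime_tPoly_sub [IsDomain R] (h2 : IsUnit (2 : R)) {a b : SignedIndex n} (h : a ≠ b) :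
    Prime (tPoly R a - tPoly R b) := by
  by_cases hi : a.idx = b.idx
  · rw [tPoly_sub_eq_two_mul hi h]
    have h2' : IsUnit (2 : MvPolynomial (Fin n) R) := by
      have := h2.map (MvPolynomial.C (R := R) (σ := Fin n))
      rwa [map_ofNat] at this
    exact (associated_unit_mul_left _ _ h2').prime_iff.2 (prime_tPoly a)
  · exact prime_tPoly_sub_of_idx_ne hi

theorem SignedIndex.sgn_mul_self (a : SignedIndex n) :
    ((a.sgn : ℤ) : R) * ((a.sgn : ℤ) : R) = 1 := by
  rcases Int.units_eq_one_or a.sgn with h | h <;> simp [h]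

/-- At the unit vector of the index of `c` the left form vanishes, while the right one is `±1` or
`±2`. -/
theorem not_tPoly_sub_dvd_of_idx_ne [IsDomain R] (h2 : (2 : R) ≠ 0) {a b c d : SignedIndex n}
    (hcd : c ≠ d) (ha : a.idx ≠ c.idx) (hb : b.idx ≠ c.idx) :
    ¬ tPoly R a - tPoly R b ∣ tPoly R c - tPoly R d := by
  intro h
  have := map_dvd (MvPolynomial.eval (Function.update (0 : Fin n → R) c.idx 1)) h
  rw [map_sub, map_sub, eval_tPoly, eval_tPoly, eval_tPoly, eval_tPoly] at this
  simp only [Function.update_self, Function.update_of_ne ha, Function.update_of_ne hb,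
    Pi.zero_apply, mul_zero, sub_zero, zero_dvd_iff, mul_one] at this
  have h1 := SignedIndex.sgn_mul_self (R := R) c
  by_cases hd : d.idx = c.idx
  · rcases SignedIndex.eq_or_eq_neg hd with hd | hd
    · exact hcd hd.symm
    · have hs : d.sgn = -c.sgn := by rw [hd]; rfl
      rw [hs, hd, SignedIndex.neg_idx, Function.update_self] at this
      apply h2
      push_cast at this
      linear_combination (c.sgn : ℤ) * this - 2 * h1
  · rw [Function.update_of_ne hd] at this
    apply one_ne_zero (α := R)
    simp only [Pi.zero_apply, mul_zero, sub_zero] at this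
    rw [← h1, this, zero_mul]

theorem tPoly_sub_ne_zero [IsDomain R] (h2 : (2 : R) ≠ 0) {a b : SignedIndex n} (h : a ≠ b) :
    tPoly R a - tPoly R b ≠ 0 := by
  by_cases hi : a.idx = b.idx
  · rw [tPoly_sub_eq_two_mul hi h]
    refine mul_ne_zero (fun h0 => h2 ?_) (prime_tPoly a).ne_zero
    exact MvPolynomial.C_injective (Fin n) R (by rwa [map_ofNat, map_zero])
  · exact (prime_tPoly_sub_of_idx_ne hi).ne_zero

/-- If `b = -a`, then `c` involves another variable and the previous lemma applies. Otherwise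
evaluate where `t_a = t_b = 1` and the other variables vanish: there `t_c` is `0` or `-1`. -/
theorem not_tPoly_sub_dvd [IsDomain R] (h2 : (2 : R) ≠ 0) {a b c : SignedIndex n}
    (hab : a ≠ b) (hac : a ≠ c) (hbc : b ≠ c) :
    ¬ tPoly R a - tPoly R b ∣ tPoly R a - tPoly R c := by
  by_cases hi : a.idx = b.idx
  · have hci : c.idx ≠ a.idx := by
      intro h
      rcases SignedIndex.eq_or_eq_neg hi with h1 | h1
      · exact hab h1
      · rcases SignedIndex.eq_or_eq_neg h with h3 | h3
        · exact hac h3.symm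
        · exact hbc (by rw [h3, h1, SignedIndex.neg_neg'])
    intro h
    rw [← neg_sub (tPoly R c), dvd_neg] at h
    exact not_tPoly_sub_dvd_of_idx_ne h2 hac.symm (Ne.symm hci) (by rw [← hi]; exact Ne.symm hci) h
  · intro h
    set x : Fin n → R := Function.update (Function.update 0 b.idx ((b.sgn : ℤ) : R)) a.idx
      ((a.sgn : ℤ) : R) with hx
    have ea : MvPolynomial.eval x (tPoly R a) = 1 := by
      rw [eval_tPoly, hx, Function.update_self, SignedIndex.sgn_mul_self]
    have eb : MvPolynomial.eval x (tPoly R b) = 1 := by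
      rw [eval_tPoly, hx, Function.update_of_ne (Ne.symm hi), Function.update_self,
        SignedIndex.sgn_mul_self]
    have := map_dvd (MvPolynomial.eval x) h
    rw [map_sub, map_sub, ea, eb, sub_self, zero_dvd_iff] at this
    by_cases h3 : c.idx = a.idx
    · rcases SignedIndex.eq_or_eq_neg h3 with h4 | h4
      · exact hac h4.symm
      · rw [h4, tPoly_neg, map_neg, ea] at this
        exact h2 (by linear_combination this)
    by_cases h3' : c.idx = b.idx
    · rcases SignedIndex.eq_or_eq_neg h3' with h4 | h4
      · exact hbc h4.symm
      · rw [h4, tPoly_neg, map_neg, eb] at this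
        exact h2 (by linear_combination this)
    rw [eval_tPoly, hx, Function.update_of_ne h3, Function.update_of_ne h3'] at this
    simp at this

end Linear

/-! ### Evaluation at a signed permutation. -/

section Evaluation

variable (R : Type) [CommRing R]

/-- The evaluation of a polynomial in `τ` and `t` at a signed permutation `w`: `τ_i ↦ t_{w(i)}`. -/
def evalAt (w : SignedPerm n) :
    MvPolynomial (Fin n ⊕ Fin n) R →ₐ[R] MvPolynomial (Fin n) R :=
  MvPolynomial.aeval (Sum.elim (fun i => tPoly R (w.val i)) MvPolynomial.X)

/-- Polynomials in `t` as polynomials in `τ` and `t`. -/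
def inclT : MvPolynomial (Fin n) R →ₐ[R] MvPolynomial (Fin n ⊕ Fin n) R :=
  MvPolynomial.rename Sum.inr

@[simp] theorem evalAt_inclT (w : SignedPerm n) (f : MvPolynomial (Fin n) R) :
    evalAt R w (inclT R f) = f := by
  rw [evalAt, inclT, MvPolynomial.aeval_rename, Sum.elim_comp_inr, MvPolynomial.aeval_X_left_apply]

@[simp] theorem evalAt_inl (w : SignedPerm n) (i : Fin n) :
    evalAt R w (MvPolynomial.X (Sum.inl i)) = tPoly R (w.val i) := by
  simp [evalAt]

@[simp] theorem evalAt_inr (w : SignedPerm n) (i : Fin n) :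
    evalAt R w (MvPolynomial.X (Sum.inr i)) = MvPolynomial.X i := by
  simp [evalAt]

theorem evalAt_isHomogeneous (w : SignedPerm n) {p : MvPolynomial (Fin n ⊕ Fin n) R} {k : ℕ}
    (hp : p.IsHomogeneous k) : (evalAt R w p).IsHomogeneous k := by
  have := hp.aeval (Sum.elim (fun i => tPoly R (w.val i)) MvPolynomial.X) (n := 1) (by
    rintro (i | i)
    · exact tPoly_isHomogeneous R _
    · exact MvPolynomial.isHomogeneous_X R i)
  simpa using! this

theorem homogeneousComponent_evalAt (w : SignedPerm n) (p : MvPolynomial (Fin n ⊕ Fin n) R)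
    (k : ℕ) : MvPolynomial.homogeneousComponent k (evalAt R w p) =
      evalAt R w (MvPolynomial.homogeneousComponent k p) := by
  conv_lhs => rw [← MvPolynomial.sum_homogeneousComponent p, map_sum, map_sum]
  have : ∀ i, MvPolynomial.homogeneousComponent k
      (evalAt R w (MvPolynomial.homogeneousComponent i p)) =
      if i = k then evalAt R w (MvPolynomial.homogeneousComponent i p) else 0 := fun i => by
    rw [MvPolynomial.homogeneousComponent_of_mem
      (evalAt_isHomogeneous R w (MvPolynomial.homogeneousComponent_isHomogeneous i p))]
    simp [eq_comm]
  simp only [this, Finset.sum_ite_eq', Finset.mem_range]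
  split_ifs with h
  · rfl
  · rw [MvPolynomial.homogeneousComponent_eq_zero k p (by omega), map_zero]

end Evaluation

/-- Modulo the label of the edge the two evaluations agree on every variable, because all nonzero
differences `t_{w(i)} - t_{w'(i)}` along one edge are equal up to sign. -/
theorem tPoly_sub_dvd_evalAt_sub {R : Type} [CommRing R] {w w' : SignedPerm n}
    (e : (graphC n).Adj w w') {j : Fin n} (hj : w'.val j ≠ w.val j)
    (g : MvPolynomial (Fin n ⊕ Fin n) R) :
    tPoly R (w.val j) - tPoly R (w'.val j) ∣ evalAt R w g - evalAt R w' g := by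
  rw [← Ideal.mem_span_singleton, ← Ideal.Quotient.eq]
  set J := Ideal.span {tPoly R (w.val j) - tPoly R (w'.val j)} with hJ
  have : (Ideal.Quotient.mkₐ R J).comp (evalAt R w) =
      (Ideal.Quotient.mkₐ R J).comp (evalAt R w') := by
    apply MvPolynomial.algHom_ext
    rintro (i | i)
    · simp only [AlgHom.comp_apply, evalAt_inl, Ideal.Quotient.mkₐ_eq_mk]
      rw [Ideal.Quotient.eq, hJ, Ideal.mem_span_singleton]
      by_cases hi : w'.val i = w.val i
      · rw [hi, sub_self]
        exact dvd_zero _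
      · have key : ∀ k, MvPolynomial.map (Int.castRingHom R)
            ((tSigned (w.val k) - tSigned (w'.val k) : H2BT n) : HBT n) =
            tPoly R (w.val k) - tPoly R (w'.val k) := fun k => by
          rw [AddSubgroupClass.coe_sub, map_sub, map_tSigned, map_tSigned]
        rw [← key, ← key]
        rcases graphC_sub_eq e hi hj with h | h
        · rw [h]
        · rw [h, NegMemClass.coe_neg, map_neg, dvd_neg]
    · simp only [AlgHom.comp_apply, evalAt_inr]
  exact DFunLike.congr_fun this g

/-! ### Surjectivity by Newton interpolation. -/

/-- A function on the vertices satisfying the divisibility conditions on the edges is a polynomial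
in `τ` and `t`. -/
theorem exists_evalAt_eq_of_agreeOff {R : Type} [CommRing R] [IsDomain R] (h2 : IsUnit (2 : R))
    (G : Finset (Fin n)) : ∀ (v : SignedPerm n) (h : SignedPerm n → MvPolynomial (Fin n) R),
    (∀ w w', AgreeOff G v w → AgreeOff G v w' → (graphC n).Adj w w' → ∀ i, w'.val i ≠ w.val i →
      tPoly R (w.val i) - tPoly R (w'.val i) ∣ h w - h w') →
    ∃ g, ∀ w, AgreeOff G v w → h w = evalAt R w g := by
  classical
  have h20 : (2 : R) ≠ 0 := h2.ne_zero
  induction G using Finset.induction_on with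
  | empty =>
    intro v h _
    refine ⟨inclT R (h v), fun w hw => ?_⟩
    rw [SignedPerm.ext_val fun i => hw i (Finset.notMem_empty i), evalAt_inclT]
  | insert i G hi ih =>
    intro v h hh
    have hiG := Finset.mem_insert_self i G
    -- `T` is a set of positions `p`, standing for the values `v(p)` that may occur at `i`
    have key : ∀ T : Finset (SignedIndex n), (∀ p ∈ T, p.idx ∈ insert i G) →
        ∃ g, ∀ w, AgreeOff (insert i G) v w → (∃ p ∈ T, w.val i = v.1 p) →
          h w = evalAt R w g := by
      intro T
      induction T using Finset.induction_on with
      | empty => exact fun _ => ⟨0, by simp⟩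
      | insert p T hpT ihT =>
        intro hT
        obtain ⟨g, hg⟩ := ihT fun q hq => hT q (Finset.mem_insert_of_mem hq)
        obtain ⟨v', hv', hv'i⟩ := AgreeOff.exists_val_eq (insert i G) v hiG
          (hT p (Finset.mem_insert_self p T))
        -- The value of the Newton factor `∏ (τ_i - t_{v(q)})` on the layer `w(i) = v(p)`, constant
        -- there.
        set D : MvPolynomial (Fin n) R := ∏ q ∈ T, (tPoly R (v.1 p) - tPoly R (v.1 q)) with hD
        have hedge : ∀ w w', AgreeOff (insert i G) v w → AgreeOff (insert i G) v w' →
            (graphC n).Adj w w' → ∀ j, w'.val j ≠ w.val j →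
            tPoly R (w.val j) - tPoly R (w'.val j) ∣
              (h w - evalAt R w g) - (h w' - evalAt R w' g) := by
          intro w w' hw hw' hadj j hj
          rw [sub_sub_sub_comm]
          exact dvd_sub (hh w w' hw hw' hadj j hj) (tPoly_sub_dvd_evalAt_sub hadj hj g)
        have hdiv : ∀ w, AgreeOff G v' w → D ∣ h w - evalAt R w g := by
          intro w hw
          have hwi : w.val i = v.1 p := (hw i hi).trans hv'i
          have hw' : AgreeOff (insert i G) v w := hv'.of_insert hw
          have aux : ∀ S ⊆ T, ∏ q ∈ S, (tPoly R (v.1 p) - tPoly R (v.1 q)) ∣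
              h w - evalAt R w g := by
            intro S
            induction S using Finset.induction_on with
            | empty => simp
            | insert q S hqS ihS =>
              intro hST
              obtain ⟨u, hu⟩ := ihS ((Finset.subset_insert q S).trans hST)
              have hqT : q ∈ T := hST (Finset.mem_insert_self q S)
              have hpq : v.1 p ≠ v.1 q := fun h' => hpT (v.1.injective h' ▸ hqT)
              -- At this neighbour the error is already zero, so the label divides the error at `w`
              -- itself.
              obtain ⟨w', hw'1, hw'2, hw'3⟩ := hw'.exists_adj hiG
                (hT q (Finset.mem_insert_of_mem hqT)) (hwi ▸ hpq)
              have hd := hedge w w' hw' hw'1 hw'3 i (by rw [hwi, hw'2]; exact hpq.symm)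
              rw [hg w' hw'1 ⟨q, hqT, hw'2⟩, sub_self, sub_zero, hwi, hw'2, hu] at hd
              have hprime := prime_tPoly_sub h2 hpq
              rw [Finset.prod_insert hqS, hu, mul_comm (tPoly R (v.1 p) - tPoly R (v.1 q))]
              refine mul_dvd_mul_left _ ((hprime.dvd_or_dvd hd).resolve_left ?_)
              rw [hprime.dvd_finsetProd_iff]
              rintro ⟨r, hr, hdvd⟩
              refine not_tPoly_sub_dvd h20 hpq ?_ ?_ hdvd
              · exact fun h' => hpT (v.1.injective h' ▸ (hST (Finset.mem_insert_of_mem hr) : r ∈ T))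
              · exact fun h' => hqS (v.1.injective h' ▸ hr)
          exact aux T subset_rfl
        choose! k hk using hdiv
        obtain ⟨g', hg'⟩ := ih v' k (by
          intro w w' hw hw' hadj j hj
          have hji : j ≠ i := by
            rintro rfl
            exact hj ((hw' j hi).trans (hw j hi).symm)
          have hd := hedge w w' (hv'.of_insert hw) (hv'.of_insert hw') hadj j hj
          rw [hk w hw, hk w' hw', ← mul_sub] at hd
          have hprime := prime_tPoly_sub h2 hj.symm
          refine (hprime.dvd_or_dvd hd).resolve_left ?_
          rw [hprime.dvd_finsetProd_iff]
          rintro ⟨r, hr, hdvd⟩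
          -- Within the layer, `±v(p)` is used up at `±i`, so the label at `j` omits a variable that
          -- every factor of `D` contains.
          have hidx : ∀ u : SignedPerm n, AgreeOff G v' u → (u.val j).idx ≠ (v.1 p).idx := by
            intro u hu h'
            have hui : u.val i = v.1 p := (hu i hi).trans hv'i
            rw [← hui] at h'
            rcases SignedIndex.eq_or_eq_neg h' with h' | h'
            · exact hji (u.val_inj h')
            · exact u.val_ne_neg _ _ h'
          have hpr : v.1 p ≠ v.1 r := fun h' => hpT (v.1.injective h' ▸ hr)
          exact not_tPoly_sub_dvd_of_idx_ne h20 hpr (hidx w hw) (hidx w' hw') hdvd)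
        refine ⟨g + (∏ q ∈ T, (MvPolynomial.X (Sum.inl i) - inclT R (tPoly R (v.1 q)))) * g',
          fun w hw hwp => ?_⟩
        have heval : evalAt R w (∏ q ∈ T, (MvPolynomial.X (Sum.inl i) -
            inclT R (tPoly R (v.1 q)))) =
            ∏ q ∈ T, (tPoly R (w.val i) - tPoly R (v.1 q)) := by
          simp [map_prod]
        rw [map_add, map_mul, heval]
        by_cases hT' : ∃ q ∈ T, w.val i = v.1 q
        · rw [hg w hw hT']
          obtain ⟨q, hq, hwq⟩ := hT'
          rw [Finset.prod_eq_zero hq (by rw [hwq, sub_self]), zero_mul, add_zero]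
        · obtain ⟨q, hq, hwq⟩ := hwp
          rcases Finset.mem_insert.1 hq with rfl | hq
          · have hw' := hv'.of_insert_of_val_eq hw (hwq.trans hv'i.symm)
            rw [← hg' w hw', hwq, ← hD, ← hk w hw', add_sub_cancel]
          · exact absurd ⟨q, hq, hwq⟩ hT'
    have := Fintype.ofFinite (SignedIndex n)
    obtain ⟨g, hg⟩ := key (Finset.univ.filter fun p => p.idx ∈ insert i G) (by simp)
    refine ⟨g, fun w hw => hg w hw ⟨v.1.symm (w.val i), ?_, by simp⟩⟩
    simp only [Finset.mem_filter, Finset.mem_univ, true_and]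
    exact hw.mem_of_apply_eq (q := ⟨i, 1⟩) (by simp [SignedPerm.val]) hiG

/-! ### The kernel of the evaluations. -/

section Kernel

variable (R : Type) [CommRing R]

/-- The ideal `idealC n R` together with the relations `τ_i = t_{v(i)}` for `i ∉ G`. -/
def relIdeal (G : Finset (Fin n)) (v : SignedPerm n) : Ideal (MvPolynomial (Fin n ⊕ Fin n) R) :=
  idealC n R ⊔ Ideal.span {f | ∃ i, i ∉ G ∧
    f = MvPolynomial.X (Sum.inl i) - inclT R (tPoly R (v.val i))}

variable {R}

theorem X_sub_mem_relIdeal {G : Finset (Fin n)} {v : SignedPerm n} {i : Fin n} (hi : i ∉ G) :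
    MvPolynomial.X (Sum.inl i) - inclT R (tPoly R (v.val i)) ∈ relIdeal R G v :=
  Ideal.mem_sup_right (Ideal.subset_span ⟨i, hi, rfl⟩)

/-- The permutation of `[n]` underlying a signed permutation. -/
def SignedPerm.absPerm (w : SignedPerm n) : Equiv.Perm (Fin n) :=
  Equiv.ofBijective (fun i => (w.val i).idx) (Finite.injective_iff_bijective.1 fun i j h => by
    rcases SignedIndex.eq_or_eq_neg h with h | h
    · exact w.val_inj h
    · exact absurd h (w.val_ne_neg i j))

/-- Squaring forgets signs, so `w` merely permutes the `t_j ^ 2`. -/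
theorem idealC_le_ker_evalAt (w : SignedPerm n) :
    idealC n R ≤ RingHom.ker (evalAt R w) := by
  rw [idealC, Ideal.span_le]
  rintro _ ⟨i, -, -, rfl⟩
  rw [SetLike.mem_coe, RingHom.mem_ker, map_sub, sub_eq_zero, ← AlgHom.comp_apply,
    ← AlgHom.comp_apply, MvPolynomial.comp_aeval, MvPolynomial.comp_aeval]
  simp only [map_pow, evalAt_inl, evalAt_inr, tPoly_sq]
  have h := MvPolynomial.esymm_isSymmetric (Fin n) R i w.absPerm
  conv_rhs => rw [← h]
  rw [MvPolynomial.aeval_rename]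
  rfl

theorem evalAt_eq_zero_of_mem_relIdeal {G : Finset (Fin n)} {v w : SignedPerm n}
    (hw : AgreeOff G v w) {f : MvPolynomial (Fin n ⊕ Fin n) R} (hf : f ∈ relIdeal R G v) :
    evalAt R w f = 0 := by
  have : relIdeal R G v ≤ RingHom.ker (evalAt R w) := by
    refine sup_le (idealC_le_ker_evalAt w) ?_
    rw [Ideal.span_le]
    rintro _ ⟨i, hi, rfl⟩
    rw [SetLike.mem_coe, RingHom.mem_ker, map_sub, evalAt_inl, evalAt_inclT, hw i hi, sub_self]
  exact this hf

open Polynomial in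
/-- In a quotient by an ideal containing `idealC`, the polynomials with roots `τ_j ^ 2` and
`t_j ^ 2` coincide. -/
theorem prod_X_sub_C_eq_of_idealC {B : Type} [CommRing B]
    (f : MvPolynomial (Fin n ⊕ Fin n) R →+* B) (hf : ∀ p ∈ idealC n R, f p = 0) :
    ∏ j : Fin n, (X - C (f (MvPolynomial.X (Sum.inl j)) ^ 2)) =
      ∏ j : Fin n, (X - C (f (MvPolynomial.X (Sum.inr j)) ^ 2)) := by
  let _ : Algebra R B := (f.comp MvPolynomial.C).toAlgebra
  let f' : MvPolynomial (Fin n ⊕ Fin n) R →ₐ[R] B := { f with commutes' := fun _ => rfl }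
  have he : ∀ k ≤ n,
      (Finset.univ.val.map fun j : Fin n => f (MvPolynomial.X (Sum.inl j)) ^ 2).esymm k =
      (Finset.univ.val.map fun j : Fin n => f (MvPolynomial.X (Sum.inr j)) ^ 2).esymm k := by
    intro k hk
    rcases Nat.eq_zero_or_pos k with rfl | hk0
    · simp [Multiset.esymm]
    have h1 := hf _ (Ideal.subset_span ⟨k, hk0, hk, rfl⟩)
    change f' _ = 0 at h1
    rw [map_sub, sub_eq_zero, ← AlgHom.comp_apply, ← AlgHom.comp_apply, MvPolynomial.comp_aeval,
      MvPolynomial.comp_aeval, MvPolynomial.aeval_esymm_eq_multiset_esymm,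
      MvPolynomial.aeval_esymm_eq_multiset_esymm] at h1
    simpa only [map_pow] using! h1
  have key : ∀ g : Fin n → B, ∏ j : Fin n, (X - C (g j)) =
      ∑ k ∈ Finset.range (n + 1),
        (-1) ^ k * (C ((Finset.univ.val.map g).esymm k) * X ^ (n - k)) := by
    intro g
    have := Multiset.prod_X_sub_X_eq_sum_esymm (Finset.univ.val.map g)
    rw [Multiset.map_map, Multiset.card_map, Finset.card_val, Finset.card_univ,
      Fintype.card_fin] at this
    exact this
  rw [key, key]
  refine Finset.sum_congr rfl fun k hk => ?_
  rw [he k (Nat.lt_succ_iff.1 (Finset.mem_range.1 hk))]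

-- In the quotient, `∏ (X - τ_j ^ 2) = ∏ (X - t_{v(j)} ^ 2)`. The factors with `j ∉ G` coincide and
-- are monic, hence cancel; then put `X = τ_i ^ 2`.
open Polynomial in
theorem prod_sq_sub_sq_mem_relIdeal (G : Finset (Fin n)) (v : SignedPerm n) {i : Fin n}
    (hi : i ∈ G) :
    ∏ j ∈ G, ((MvPolynomial.X (Sum.inl i)) ^ 2 - inclT R (tPoly R (v.val j)) ^ 2) ∈
      relIdeal R G v := by
  classical
  set J := relIdeal R G v
  set f := Ideal.Quotient.mk J
  have h := prod_X_sub_C_eq_of_idealC f fun p hp =>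
    Ideal.Quotient.eq_zero_iff_mem.2 (Ideal.mem_sup_left hp)
  have h1 : ∀ j, f (MvPolynomial.X (Sum.inr (v.absPerm j))) ^ 2 =
      f (inclT R (tPoly R (v.val j))) ^ 2 := by
    intro j
    rw [← map_pow, ← map_pow, ← map_pow, tPoly_sq]
    simp [inclT, SignedPerm.absPerm]
  rw [← Equiv.prod_comp v.absPerm fun j => X - C (f (MvPolynomial.X (Sum.inr j)) ^ 2)] at h
  simp only [h1] at h
  have h2 : ∀ j ∉ G, f (MvPolynomial.X (Sum.inl j)) = f (inclT R (tPoly R (v.val j))) :=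
    fun j hj => Ideal.Quotient.eq.2 (X_sub_mem_relIdeal hj)
  rw [← Finset.prod_compl_mul_prod G, ← Finset.prod_compl_mul_prod G,
    Finset.prod_congr rfl fun j hj => by rw [h2 j (Finset.mem_compl.1 hj)]] at h
  have hm : (∏ j ∈ Gᶜ, (X - C (f (inclT R (tPoly R (v.val j))) ^ 2))).Monic :=
    monic_prod_of_monic _ _ fun j _ => monic_X_sub_C _
  have h3 := hm.isRegular.left h
  have h4 := congrArg (eval (f (MvPolynomial.X (Sum.inl i)) ^ 2)) h3
  rw [eval_prod, eval_prod, Finset.prod_eq_zero hi (by simp)] at h4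
  rw [← Ideal.Quotient.eq_zero_iff_mem, map_prod]
  simpa using h4.symm

theorem prod_X_sub_mem_relIdeal (G : Finset (Fin n)) (v : SignedPerm n) {i : Fin n}
    (hi : i ∈ G) :
    ∏ p ∈ G ×ˢ (Finset.univ : Finset ℤˣ),
      (MvPolynomial.X (Sum.inl i) - inclT R (tPoly R (v.1 ⟨p.1, p.2⟩))) ∈ relIdeal R G v := by
  have h := prod_sq_sub_sq_mem_relIdeal (R := R) G v hi
  rw [Finset.prod_product]
  convert h using 2 with j _
  have hu : (Finset.univ : Finset ℤˣ) = {1, -1} := rfl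
  have h1 : v.1 ⟨j, -1⟩ = -v.val j := v.2 ⟨j, 1⟩
  rw [hu, Finset.prod_pair (by decide), h1, tPoly_neg, map_neg]
  change (_ - inclT R (tPoly R (v.val j))) * _ = _
  ring

/-- A polynomial in `τ` and `t` that vanishes at all signed permutations agreeing with `v` outside
`G` lies in `relIdeal R G v`. -/
theorem mem_relIdeal_of_evalAt_eq_zero [IsDomain R] (h2 : (2 : R) ≠ 0) (G : Finset (Fin n)) :
    ∀ (v : SignedPerm n) (g : MvPolynomial (Fin n ⊕ Fin n) R),
    (∀ w, AgreeOff G v w → evalAt R w g = 0) → g ∈ relIdeal R G v := by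
  classical
  induction G using Finset.induction_on with
  | empty =>
    intro v g hg
    have h : (Ideal.Quotient.mkₐ R (relIdeal R ∅ v)).comp ((inclT R).comp (evalAt R v)) =
        Ideal.Quotient.mkₐ R (relIdeal R ∅ v) := by
      apply MvPolynomial.algHom_ext
      rintro (i | i)
      · simp only [AlgHom.comp_apply, evalAt_inl, Ideal.Quotient.mkₐ_eq_mk]
        exact (Ideal.Quotient.eq.2 (X_sub_mem_relIdeal (Finset.notMem_empty i))).symm
      · simp [inclT]
    have h1 := DFunLike.congr_fun h g
    rw [AlgHom.comp_apply, AlgHom.comp_apply, hg v (AgreeOff.refl _ v), map_zero, map_zero] at h1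
    exact Ideal.Quotient.eq_zero_iff_mem.1 h1.symm
  | insert i G hi ih =>
    intro v g hg
    have hiG := Finset.mem_insert_self i G
    have key : ∀ T ⊆ insert i G ×ˢ (Finset.univ : Finset ℤˣ), ∃ q,
        g - (∏ p ∈ T, (MvPolynomial.X (Sum.inl i) - inclT R (tPoly R (v.1 ⟨p.1, p.2⟩)))) * q ∈
          relIdeal R (insert i G) v := by
      intro T
      induction T using Finset.induction_on with
      | empty => exact fun _ => ⟨g, by simp⟩
      | insert p T hpT ihT =>
        intro hT
        obtain ⟨q, hq⟩ := ihT ((Finset.subset_insert p T).trans hT)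
        have hpG : p.1 ∈ insert i G :=
          (Finset.mem_product.1 (hT (Finset.mem_insert_self p T))).1
        obtain ⟨v', hv', hv'i⟩ := AgreeOff.exists_val_eq (insert i G) v hiG
          (p := ⟨p.1, p.2⟩) hpG
        have hqv : q ∈ relIdeal R G v' := by
          refine ih v' q fun w hw => ?_
          have hwi : w.val i = v.1 ⟨p.1, p.2⟩ := (hw i hi).trans hv'i
          have hw' := hv'.of_insert hw
          have h0 := evalAt_eq_zero_of_mem_relIdeal hw' hq
          rw [map_sub, hg w hw', zero_sub, neg_eq_zero, map_mul, map_prod] at h0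
          -- On the layer `w(i) = v(p)` no factor indexed by `T` vanishes, as `p ∉ T`; so `q` does.
          refine (mul_eq_zero.1 h0).resolve_left (Finset.prod_ne_zero_iff.2 fun r hr => ?_)
          rw [map_sub, evalAt_inl, evalAt_inclT, hwi]
          refine tPoly_sub_ne_zero h2 fun h' => hpT ?_
          have h'' := v.1.injective h'
          have : p = r := Prod.ext (congrArg SignedIndex.idx h'') (congrArg SignedIndex.sgn h'')
          rwa [this]
        have hle : relIdeal R G v' ≤ relIdeal R (insert i G) v ⊔
            Ideal.span {MvPolynomial.X (Sum.inl i) - inclT R (tPoly R (v.1 ⟨p.1, p.2⟩))} := by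
          refine sup_le (le_sup_of_le_left le_sup_left) ?_
          rw [Ideal.span_le]
          rintro _ ⟨j, hj, rfl⟩
          by_cases hji : j = i
          · rw [hji, hv'i]
            exact Ideal.mem_sup_right (Ideal.mem_span_singleton_self _)
          · have hj' : j ∉ insert i G := by simp [hji, hj]
            rw [hv' j hj']
            exact Ideal.mem_sup_left (X_sub_mem_relIdeal hj')
        obtain ⟨a, ha, b, hb, rfl⟩ := Submodule.mem_sup.1 (hle hqv)
        obtain ⟨c, rfl⟩ := Ideal.mem_span_singleton'.1 hb
        refine ⟨c, ?_⟩
        rw [Finset.prod_insert hpT]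
        convert add_mem hq (Ideal.mul_mem_left _ (∏ p ∈ T,
          (MvPolynomial.X (Sum.inl i) - inclT R (tPoly R (v.1 ⟨p.1, p.2⟩)))) ha) using 1
        ring
    obtain ⟨q, hq⟩ := key _ subset_rfl
    -- With all values used, the Newton product is itself a relation.
    have := add_mem hq (Ideal.mul_mem_right q _ (prod_X_sub_mem_relIdeal (R := R) _ v hiG))
    rwa [sub_add_cancel] at this

/-- The identity signed permutation. -/
def SignedPerm.one (n : ℕ) : SignedPerm n := ⟨Equiv.refl _, fun _ => rfl⟩

theorem mem_idealC_iff [IsDomain R] (h2 : (2 : R) ≠ 0) {g : MvPolynomial (Fin n ⊕ Fin n) R} :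
    g ∈ idealC n R ↔ ∀ w, evalAt R w g = 0 := by
  refine ⟨fun hg w => idealC_le_ker_evalAt w hg, fun hg => ?_⟩
  have := mem_relIdeal_of_evalAt_eq_zero h2 Finset.univ (SignedPerm.one n) g fun w _ => hg w
  simpa [relIdeal] using this

end Kernel

/-! ### The presentation after inverting 2. -/

section Tensor

/-- The polynomials in `τ_i` and `t_i` with integer coefficients, as elements of the graph
cohomology ring. -/
def polyC (n : ℕ) : MvPolynomial (Fin n ⊕ Fin n) ℤ →ₐ[ℤ] graphCohomology (typeC n) :=
  MvPolynomial.aeval (Sum.elim (tauC n) (tC n))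

theorem polyC_apply (g : MvPolynomial (Fin n ⊕ Fin n) ℤ) (w : SignedPerm n) :
    (polyC n g : SignedPerm n → HBT n) w = evalAt ℤ w g := by
  have : ((Pi.evalRingHom _ w).comp ((graphCohomology (typeC n)).subtype.comp
      (polyC n : MvPolynomial (Fin n ⊕ Fin n) ℤ →+* _))) =
      (evalAt ℤ w : MvPolynomial (Fin n ⊕ Fin n) ℤ →+* _) := by
    apply MvPolynomial.ringHom_ext
    · intro r
      simp
    · rintro (i | i)
      · simp [polyC, tauC, tSigned_eq_tPoly]
      · simp [polyC, tC]
  exact DFunLike.congr_fun this g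

variable (R : Type) [CommRing R]

/-- Extension of scalars of the elements of the graph cohomology ring. -/
def tensorToFun (n : ℕ) : R ⊗[ℤ] graphCohomology (typeC n) →ₐ[R]
    (SignedPerm n → MvPolynomial (Fin n) R) :=
  Algebra.TensorProduct.lift (Algebra.ofId R _)
    (RingHom.toIntAlgHom (RingHom.pi fun w => (MvPolynomial.map (Int.castRingHom R)).comp
      ((Pi.evalRingHom _ w).comp (graphCohomology (typeC n)).subtype)))
    fun _ _ => Commute.all _ _

theorem tensorToFun_one_tmul (h : graphCohomology (typeC n)) (w : SignedPerm n) :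
    tensorToFun R n (1 ⊗ₜ[ℤ] h) w =
      MvPolynomial.map (Int.castRingHom R) ((h : SignedPerm n → HBT n) w) := by
  simp [tensorToFun]

/-- The polynomials in `τ_i` and `t_i` with coefficients in `R`, as elements of the graph
cohomology ring tensored with `R`. -/
def polyTensor (n : ℕ) :
    MvPolynomial (Fin n ⊕ Fin n) R →ₐ[R] R ⊗[ℤ] graphCohomology (typeC n) :=
  MvPolynomial.aeval (Sum.elim (fun i => 1 ⊗ₜ[ℤ] tauC n i) (fun i => 1 ⊗ₜ[ℤ] tC n i))

theorem tensorToFun_polyTensor (g : MvPolynomial (Fin n ⊕ Fin n) R) (w : SignedPerm n) :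
    tensorToFun R n (polyTensor R n g) w = evalAt R w g := by
  have : ((Pi.evalAlgHom R _ w).comp ((tensorToFun R n).comp (polyTensor R n))) = evalAt R w := by
    apply MvPolynomial.algHom_ext
    rintro (i | i)
    · simp [polyTensor, tensorToFun_one_tmul, tauC, map_tSigned]
    · simp [polyTensor, tensorToFun_one_tmul, tC]
  exact DFunLike.congr_fun this g

theorem polyTensor_monomial (d : Fin n ⊕ Fin n →₀ ℕ) (c : R) :
    polyTensor R n (MvPolynomial.monomial d c) =
      c • (1 ⊗ₜ[ℤ] polyC n (MvPolynomial.monomial d 1)) := by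
  have h : (polyTensor R n : MvPolynomial (Fin n ⊕ Fin n) R →+* _).comp
      (MvPolynomial.map (Int.castRingHom R)) =
      (Algebra.TensorProduct.includeRight : graphCohomology (typeC n) →ₐ[ℤ] R ⊗[ℤ] _).toRingHom.comp
        (polyC n : MvPolynomial (Fin n ⊕ Fin n) ℤ →+* _) := by
    apply MvPolynomial.ringHom_ext
    · intro r
      simp
    · rintro (i | i) <;> simp [polyTensor, polyC]
  have h1 := DFunLike.congr_fun h (MvPolynomial.monomial d 1)
  simp only [RingHom.comp_apply, MvPolynomial.map_monomial, map_one] at h1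
  have h2 : MvPolynomial.monomial d c = c • MvPolynomial.monomial d (1 : R) := by
    rw [MvPolynomial.smul_monomial, smul_eq_mul, mul_one]
  rw [h2, map_smul]
  exact congrArg (c • ·) h1

variable [IsLocalization.Away (2 : ℤ) R]

theorem isDomain_of_away_two : IsDomain R :=
  IsLocalization.isDomain_of_le_nonZeroDivisors (M := Submonoid.powers (2 : ℤ)) R
    (powers_le_nonZeroDivisors_of_noZeroDivisors two_ne_zero)

theorem intCast_injective_of_away_two : Function.Injective (Int.castRingHom R) := by
  have := IsLocalization.injective (M := Submonoid.powers (2 : ℤ)) R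
    (powers_le_nonZeroDivisors_of_noZeroDivisors two_ne_zero)
  simpa using this

theorem isUnit_two_of_away_two : IsUnit (2 : R) := by
  simpa using IsLocalization.Away.algebraMap_isUnit (S := R) (2 : ℤ)

theorem exists_two_pow_smul_eq_one_tmul (x : R ⊗[ℤ] graphCohomology (typeC n)) :
    ∃ (k : ℕ) (h : graphCohomology (typeC n)), (2 : R) ^ k • x = 1 ⊗ₜ[ℤ] h := by
  induction x with
  | zero => exact ⟨0, 0, by simp⟩
  | tmul c h =>
    obtain ⟨⟨m, ⟨_, k, rfl⟩⟩, hm⟩ := IsLocalization.surj (Submonoid.powers (2 : ℤ)) c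
    refine ⟨k, m • h, ?_⟩
    rw [← TensorProduct.smul_tmul, TensorProduct.smul_tmul']
    congr 1
    simpa [mul_comm] using hm
  | add x y hx hy =>
    obtain ⟨k, h, hk⟩ := hx
    obtain ⟨l, h', hl⟩ := hy
    refine ⟨k + l, (2 : ℤ) ^ l • h + (2 : ℤ) ^ k • h', ?_⟩
    rw [smul_add, TensorProduct.tmul_add, TensorProduct.tmul_smul, TensorProduct.tmul_smul, ← hk,
      ← hl, ← Int.cast_smul_eq_zsmul R, ← Int.cast_smul_eq_zsmul R, smul_smul, smul_smul]
    push_cast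
    rw [pow_add, mul_comm ((2 : R) ^ l)]

/-- Clearing denominators reduces this to integral classes, which are determined by their values.
Identities in the tensor product can thus be checked vertex by vertex. -/
theorem tensorToFun_injective : Function.Injective (tensorToFun R n) := by
  rw [injective_iff_map_eq_zero]
  intro x hx
  obtain ⟨k, h, hk⟩ := exists_two_pow_smul_eq_one_tmul R x
  have h0 : h = 0 := by
    apply Subtype.ext
    funext w
    apply MvPolynomial.map_injective _ (intCast_injective_of_away_two R)
    rw [← tensorToFun_one_tmul, ← hk, map_smul, hx]
    simp
  rw [h0, TensorProduct.tmul_zero] at hk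
  exact ((isUnit_two_of_away_two R).pow k).smul_eq_zero.1 hk

theorem exists_polyTensor_eq (h : graphCohomology (typeC n)) :
    ∃ g, polyTensor R n g = 1 ⊗ₜ[ℤ] h := by
  have := isDomain_of_away_two R
  obtain ⟨g, hg⟩ := exists_evalAt_eq_of_agreeOff (isUnit_two_of_away_two R) Finset.univ
    (SignedPerm.one n)
    (fun w => MvPolynomial.map (Int.castRingHom R) ((h : SignedPerm n → HBT n) w)) (by
      intro w w' _ _ hadj i hi
      have h1 := h.2 w w' hadj
      have h2 : ((tSigned (w.val i) - tSigned (w'.val i) : H2BT n) : HBT n) ∣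
          (h : SignedPerm n → HBT n) w - (h : SignedPerm n → HBT n) w' := by
        rcases labelC_eq hadj hi with h3 | h3
        · rwa [h3] at h1
        · rwa [h3, NegMemClass.coe_neg, neg_dvd] at h1
      have h4 := map_dvd (MvPolynomial.map (Int.castRingHom R)) h2
      rwa [AddSubgroupClass.coe_sub, map_sub, map_sub, map_tSigned, map_tSigned] at h4)
  refine ⟨g, tensorToFun_injective R (funext fun w => ?_)⟩
  rw [tensorToFun_polyTensor, tensorToFun_one_tmul, hg w fun i hi => absurd (Finset.mem_univ i) hi]

theorem polyTensor_surjective : Function.Surjective (polyTensor R n) := by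
  intro x
  induction x with
  | zero => exact ⟨0, map_zero _⟩
  | tmul c h =>
    obtain ⟨g, hg⟩ := exists_polyTensor_eq R h
    exact ⟨c • g, by rw [map_smul, hg, TensorProduct.smul_tmul', smul_eq_mul, mul_one]⟩
  | add x y hx hy =>
    obtain ⟨a, rfl⟩ := hx
    obtain ⟨b, rfl⟩ := hy
    exact ⟨a + b, map_add _ _ _⟩

theorem polyTensor_eq_zero_iff (g : MvPolynomial (Fin n ⊕ Fin n) R) :
    polyTensor R n g = 0 ↔ g ∈ idealC n R := by
  have := isDomain_of_away_two R
  rw [mem_idealC_iff (isUnit_two_of_away_two R).ne_zero,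
    ← (tensorToFun_injective R).eq_iff' (map_zero (tensorToFun R n)), funext_iff]
  simp only [tensorToFun_polyTensor, Pi.zero_apply]

/-- The presentation of the graph cohomology ring of type `C_n` after inverting `2`. -/
def presentationC (n : ℕ) : RingC n R ≃ₐ[R] R ⊗[ℤ] graphCohomology (typeC n) :=
  AlgEquiv.ofBijective
    (Ideal.Quotient.liftₐ (idealC n R) (polyTensor R n) fun g hg =>
      (polyTensor_eq_zero_iff R g).2 hg) <| by
    constructor
    · rw [injective_iff_map_eq_zero]
      intro x
      obtain ⟨g, rfl⟩ := Ideal.Quotient.mk_surjective x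
      intro hg
      exact Ideal.Quotient.eq_zero_iff_mem.2 ((polyTensor_eq_zero_iff R g).1 hg)
    · intro x
      obtain ⟨g, rfl⟩ := polyTensor_surjective R x
      exact ⟨Ideal.Quotient.mk _ g, rfl⟩

theorem presentationC_mk (g : MvPolynomial (Fin n ⊕ Fin n) R) :
    presentationC R n (Ideal.Quotient.mk _ g) = polyTensor R n g := rfl

theorem map_ringCDegree_presentationC (n k : ℕ) :
    (ringCDegree n R k).map (presentationC R n).toLinearMap =
      (graphCohomologyDegree (typeC n) k).baseChange R := by
  apply le_antisymm
  · rintro _ ⟨_, ⟨g, hg, rfl⟩, rfl⟩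
    change polyTensor R n g ∈ _
    rw [← MvPolynomial.support_sum_monomial_coeff g, map_sum]
    refine Submodule.sum_mem _ fun d hd => ?_
    rw [polyTensor_monomial]
    refine Submodule.smul_mem _ _ (Submodule.tmul_mem_baseChange_of_mem _ fun w => ?_)
    rw [polyC_apply]
    refine evalAt_isHomogeneous ℤ w (MvPolynomial.isHomogeneous_monomial _ ?_)
    rw [Finsupp.degree_eq_weight_one]
    exact hg (MvPolynomial.mem_support_iff.1 hd)
  · rw [Submodule.baseChange_eq_span, Submodule.span_le]
    rintro _ ⟨h, hh, rfl⟩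
    obtain ⟨g, hg⟩ := exists_polyTensor_eq R h
    -- Evaluation preserves degree, so the other components of `g` contribute nothing to a class of
    -- degree `k`.
    refine ⟨_, ⟨MvPolynomial.homogeneousComponent k g,
      MvPolynomial.homogeneousComponent_isHomogeneous k g, rfl⟩, ?_⟩
    change polyTensor R n _ = 1 ⊗ₜ[ℤ] h
    refine tensorToFun_injective R (funext fun w => ?_)
    rw [tensorToFun_polyTensor, ← homogeneousComponent_evalAt, ← tensorToFun_polyTensor, hg,
      tensorToFun_one_tmul]
    have := (hh w).map (Int.castRingHom R)
    rw [MvPolynomial.homogeneousComponent_of_mem this, if_pos rfl]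

end Tensor

/-! ### Failure over the integers for `n = 2`. -/

theorem not_dvd_four_of_eval_zero {L : HBT n} (hL : MvPolynomial.eval 0 L = 0) : ¬ L ∣ 4 := by
  intro h
  have := map_dvd (MvPolynomial.eval 0) h
  rw [hL, zero_dvd_iff, map_ofNat] at this
  norm_num at this

theorem eval_zero_tPoly (a : SignedIndex n) : MvPolynomial.eval 0 (tPoly ℤ a) = 0 := by
  rw [eval_tPoly, Pi.zero_apply, mul_zero]

/-- If `4 f` lies in the graph cohomology ring then so does `2 f`. -/
theorem two_mul_mem_graphCohomology {f : SignedPerm n → HBT n}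
    (hf : (4 : SignedPerm n → HBT n) * f ∈ graphCohomology (typeC n)) :
    (2 : SignedPerm n → HBT n) * f ∈ graphCohomology (typeC n) := by
  intro w w' e
  have h1 := hf w w' e
  change _ ∣ 4 * f w - 4 * f w' at h1
  change _ ∣ 2 * f w - 2 * f w'
  rw [← mul_sub] at h1 ⊢
  obtain ⟨L, hL, hl⟩ : ∃ L, IsLabelC w w' L ∧
      ((typeC n).label ⟨s(w, w'), e⟩ = L ∨ (typeC n).label ⟨s(w, w'), e⟩ = -L) := by
    obtain ⟨L, hL⟩ : ∃ L, IsLabelC w w' L := by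
      rcases e with ⟨i, j, h⟩ | ⟨i, h⟩
      · exact ⟨_, Or.inl ⟨i, j, h, rfl⟩⟩
      · exact ⟨_, Or.inr ⟨i, h, rfl⟩⟩
    exact ⟨L, hL, labelC_unique e hL⟩
  have key : ∀ f : HBT n, ((typeC n).label ⟨s(w, w'), e⟩ : HBT n) ∣ f ↔ (L : HBT n) ∣ f := by
    intro f
    rcases hl with h | h
    · rw [h]
    · rw [h, NegMemClass.coe_neg, neg_dvd]
  rw [key] at h1 ⊢
  rcases hL with ⟨i, j, ⟨hij, h, -⟩, rfl⟩ | ⟨i, h, rfl⟩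
  · rw [AddSubgroupClass.coe_sub, tSigned_eq_tPoly, tSigned_eq_tPoly] at h1 ⊢
    have hne : (w.val i).idx ≠ (w'.val i).idx := by
      intro h0
      have h2 : (w.val i).idx = (w.val j).idx := by
        rcases h with h | h
        · rw [h0, h.1]
        · rw [h0, h.1]; rfl
      rcases SignedIndex.eq_or_eq_neg h2 with h3 | h3
      · exact hij (w.val_inj h3)
      · exact w.val_ne_neg i j h3
    -- A swap label is prime over `ℤ` and does not divide 4, so it divides the difference of `f`.
    refine ((prime_tPoly_sub_of_idx_ne (R := ℤ) hne).dvd_or_dvd h1).elim (fun h4 => ?_)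
      (fun h4 => h4.mul_left _)
    exact absurd h4 (not_dvd_four_of_eval_zero (by
      rw [map_sub, eval_zero_tPoly, eval_zero_tPoly, sub_zero]))
  · have h3 : (((2 : ℤ) • tSigned (w.val i) : H2BT n) : HBT n) = 2 * tPoly ℤ (w.val i) := by
      rw [SetLike.val_smul, tSigned_eq_tPoly, zsmul_eq_mul]
      norm_num
    rw [h3] at h1 ⊢
    -- For a sign change only `t_{w(i)}` has to divide the difference of `f`; the 2 in front of `f`
    -- pays for the 2 in the label.
    refine mul_dvd_mul_left 2 (((prime_tPoly (w.val i)).dvd_or_dvd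
      ((dvd_mul_left _ _).trans h1)).resolve_left ?_)
    exact not_dvd_four_of_eval_zero (eval_zero_tPoly _)

/-- The polynomial `(τ_1 - t_2)(τ_2 - t_2)(τ_1 - τ_2 + t_1 + t_2)`. -/
def twiceClass : MvPolynomial (Fin 2 ⊕ Fin 2) ℤ :=
  (.X (.inl 0) - .X (.inr 1)) * (.X (.inl 1) - .X (.inr 1)) *
    (.X (.inl 0) - .X (.inl 1) + .X (.inr 0) + .X (.inr 1))

theorem polyC_twiceClass : polyC 2 twiceClass = (tauC 2 0 - tC 2 1) * (tauC 2 1 - tC 2 1) *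
    (tauC 2 0 - tauC 2 1 + tC 2 0 + tC 2 1) := by
  simp [polyC, twiceClass]

/-- The value is zero unless some `τ_i` equals `-t_2`. Then one of the first two factors is `-2
t_2`, and the third is `0`, `2 t_1`, `2 t_2` or `2 (t_1 + t_2)`. -/
theorem four_dvd_evalAt_twiceClass (w : SignedPerm 2) : 4 ∣ evalAt ℤ w twiceClass := by
  have hne : (w.val 0).idx ≠ (w.val 1).idx := fun h =>
    absurd (w.absPerm.injective (a₁ := 0) (a₂ := 1) h) (by decide)
  simp only [twiceClass, map_mul, map_sub, map_add, evalAt_inl, evalAt_inr, tPoly]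
  generalize w.val 0 = a at hne
  generalize w.val 1 = b at hne
  obtain ⟨i, x⟩ := a
  obtain ⟨j, y⟩ := b
  simp only at hne ⊢
  have hx := Int.units_eq_one_or x
  have hy := Int.units_eq_one_or y
  have hij : (i = 0 ∧ j = 1) ∨ (i = 1 ∧ j = 0) := by omega
  rcases hij with ⟨rfl, rfl⟩ | ⟨rfl, rfl⟩ <;> rcases hx with rfl | rfl <;>
    rcases hy with rfl | rfl <;> simp only [Units.val_one, Units.val_neg, Int.cast_one,
      Int.cast_neg, map_one, map_neg, one_mul, neg_mul] <;> first
    | exact ⟨0, by ring1⟩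
    | exact ⟨-.X 1 * (.X 0 - .X 1) * (.X 0 + .X 1), by ring1⟩
    | exact ⟨.X 1 ^ 2 * (.X 0 + .X 1), by ring1⟩
    | exact ⟨.X 0 * .X 1 * (.X 0 + .X 1), by ring1⟩

open Polynomial in
/-- A homomorphism that detects that `twiceClass` is not in the ideal generated by `2` and
`idealC 2 ℤ`. -/
def detect : MvPolynomial (Fin 2 ⊕ Fin 2) ℤ →ₐ[ℤ] DualNumber (ZMod 2)[X] :=
  MvPolynomial.aeval (Sum.elim ![TrivSqZeroExt.inl X, TrivSqZeroExt.inl X + DualNumber.eps] 0)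

open Polynomial in
theorem two_eq_zero_dualNumber : (2 : DualNumber (ZMod 2)[X]) = 0 := by
  have h : (2 : (ZMod 2)[X]) = 0 := by
    have := congrArg (C : ZMod 2 → _) (show (2 : ZMod 2) = 0 from rfl)
    simpa only [map_ofNat, map_zero] using this
  have := congrArg (TrivSqZeroExt.inlHom (ZMod 2)[X] (ZMod 2)[X]) h
  simpa only [map_ofNat, map_zero] using this

open Polynomial in
theorem dvd_detect_of_mem_idealC {p : MvPolynomial (Fin 2 ⊕ Fin 2) ℤ} (hp : p ∈ idealC 2 ℤ) :
    (TrivSqZeroExt.inl X : DualNumber (ZMod 2)[X]) ^ 4 ∣ detect p := by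
  have : idealC 2 ℤ ≤ (Ideal.span {(TrivSqZeroExt.inl X : DualNumber (ZMod 2)[X]) ^ 4}).comap
      detect := by
    rw [idealC, Ideal.span_le]
    rintro _ ⟨i, hi, hi2, rfl⟩
    rw [SetLike.mem_coe, Ideal.mem_comap, Ideal.mem_span_singleton]
    have he := DualNumber.eps_mul_eps (R := (ZMod 2)[X])
    obtain rfl | rfl : i = 1 ∨ i = 2 := by omega
    -- The image of the first relation is `2x² + 2xε + ε² = 0`; that of the second, below, is
    -- exactly `x⁴`.
    · refine Dvd.intro 0 ?_
      simp only [MvPolynomial.esymm_one, Fin.sum_univ_two, map_add, map_sub,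
        MvPolynomial.aeval_X, map_pow, detect, Sum.elim_inl, Sum.elim_inr, Matrix.cons_val_zero,
        Matrix.cons_val_one, Pi.zero_apply]
      linear_combination -he - (TrivSqZeroExt.inl X ^ 2 + TrivSqZeroExt.inl X * DualNumber.eps) *
        two_eq_zero_dualNumber
    · have h2 : MvPolynomial.esymm (Fin 2) ℤ 2 = MvPolynomial.X 0 * MvPolynomial.X 1 := by
        rw [MvPolynomial.esymm, show Finset.powersetCard 2 (Finset.univ : Finset (Fin 2)) =
          {Finset.univ} from rfl, Finset.sum_singleton, Fin.prod_univ_two]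
      refine Dvd.intro 1 ?_
      simp only [h2, map_mul, map_sub,
        MvPolynomial.aeval_X, map_pow, detect, Sum.elim_inl, Sum.elim_inr, Matrix.cons_val_zero,
        Matrix.cons_val_one, Pi.zero_apply]
      linear_combination -TrivSqZeroExt.inl X ^ 2 * he -
        TrivSqZeroExt.inl X ^ 3 * DualNumber.eps * two_eq_zero_dualNumber
  exact Ideal.mem_span_singleton.1 (this hp)

open Polynomial in
theorem two_mul_sub_twiceClass_notMem (g : MvPolynomial (Fin 2 ⊕ Fin 2) ℤ) :
    2 * g - twiceClass ∉ idealC 2 ℤ := by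
  intro h
  obtain ⟨c, hc⟩ := dvd_detect_of_mem_idealC h
  rw [map_sub, map_mul, map_ofNat, two_eq_zero_dualNumber, zero_mul, zero_sub] at hc
  have h1 : detect twiceClass = -(TrivSqZeroExt.inl X ^ 2 * DualNumber.eps) := by
    simp only [twiceClass, map_mul, map_sub, map_add, MvPolynomial.aeval_X, detect, Sum.elim_inl,
      Sum.elim_inr, Matrix.cons_val_zero, Matrix.cons_val_one, Pi.zero_apply]
    linear_combination -TrivSqZeroExt.inl X * DualNumber.eps_mul_eps (R := (ZMod 2)[X])
  rw [h1, neg_neg, TrivSqZeroExt.inl_pow, TrivSqZeroExt.inl_pow] at hc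
  -- The image of the class is `-x²ε`, so the `ε`-coordinate would make `x⁴` divide `x²`.
  have h2 := congrArg TrivSqZeroExt.snd hc
  simp at h2
  have h3 : (X : (ZMod 2)[X]) ^ 4 ∣ X ^ 2 := ⟨_, h2⟩
  have h4 := X_pow_dvd_iff.1 h3 2 (by norm_num)
  simp at h4

/-- The class `(τ_1 - t_2)(τ_2 - t_2)(τ_1 - τ_2 + t_1 + t_2) / 2` is not a polynomial in the
`τ_i` and `t_i`. -/
theorem two_mul_polyC_ne (g : MvPolynomial (Fin 2 ⊕ Fin 2) ℤ) :
    2 * polyC 2 g ≠ polyC 2 twiceClass := by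
  intro h
  refine two_mul_sub_twiceClass_notMem g ((mem_idealC_iff two_ne_zero).2 fun w => ?_)
  rw [← polyC_apply, map_sub, map_mul, map_ofNat, h, sub_self]
  rfl

theorem exists_two_mul_eq_polyC_twiceClass :
    ∃ h : graphCohomology (typeC 2), 2 * h = polyC 2 twiceClass := by
  choose f hf using four_dvd_evalAt_twiceClass
  have h4 : (4 : SignedPerm 2 → HBT 2) * f = polyC 2 twiceClass := by
    funext w
    rw [polyC_apply, hf]
    rfl
  refine ⟨⟨_, two_mul_mem_graphCohomology (h4 ▸ (polyC 2 twiceClass).2)⟩, Subtype.ext ?_⟩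
  refine Eq.trans ?_ h4
  change (2 : SignedPerm 2 → HBT 2) * (2 * f) = 4 * f
  ring

theorem mem_adjoin_iff_exists_polyC_eq {h : graphCohomology (typeC n)} :
    h ∈ Algebra.adjoin ℤ (Set.range (tauC n) ∪ Set.range (tC n)) ↔ ∃ g, polyC n g = h := by
  rw [← Set.Sum.elim_range, Algebra.adjoin_range_eq_range_aeval]
  rfl

end

theorem mainTheorem2 :
    (∀ n : ℕ, ∃ Φ : RingC n ZHalf ≃ₐ[ZHalf] ZHalf ⊗[ℤ] graphCohomology (typeC n),
      (∀ i : Fin n,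
        Φ (Ideal.Quotient.mk (idealC n ZHalf) (MvPolynomial.X (Sum.inl i))) = 1 ⊗ₜ[ℤ] tauC n i) ∧
      (∀ i : Fin n,
        Φ (Ideal.Quotient.mk (idealC n ZHalf) (MvPolynomial.X (Sum.inr i))) = 1 ⊗ₜ[ℤ] tC n i) ∧
      ∀ k : ℕ, (ringCDegree n ZHalf k).map Φ.toLinearMap =
        (graphCohomologyDegree (typeC n) k).baseChange ZHalf) ∧
    (∃ h : graphCohomology (typeC 2),
      2 * h = (tauC 2 0 - tC 2 1) * (tauC 2 1 - tC 2 1) *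
        (tauC 2 0 - tauC 2 1 + tC 2 0 + tC 2 1) ∧
      h ∉ Algebra.adjoin ℤ (Set.range (tauC 2) ∪ Set.range (tC 2))) ∧
    ¬ ∃ Φ : RingC 2 ℤ ≃+* graphCohomology (typeC 2),
      (∀ i : Fin 2,
        Φ (Ideal.Quotient.mk (idealC 2 ℤ) (MvPolynomial.X (Sum.inl i))) = tauC 2 i) ∧
      ∀ i : Fin 2,
        Φ (Ideal.Quotient.mk (idealC 2 ℤ) (MvPolynomial.X (Sum.inr i))) = tC 2 i := by
  have := ZHalf.isLocalization
  obtain ⟨h, hh⟩ := exists_two_mul_eq_polyC_twiceClass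
  refine ⟨fun n => ⟨presentationC ZHalf n, fun i => ?_, fun i => ?_,
    map_ringCDegree_presentationC ZHalf n⟩, ⟨h, hh.trans polyC_twiceClass, ?_⟩, ?_⟩
  · rw [presentationC_mk, polyTensor, MvPolynomial.aeval_X, Sum.elim_inl]
  · rw [presentationC_mk, polyTensor, MvPolynomial.aeval_X, Sum.elim_inr]
  · rw [mem_adjoin_iff_exists_polyC_eq]
    rintro ⟨g, rfl⟩
    exact two_mul_polyC_ne g hh
  · rintro ⟨Φ, h1, h2⟩
    obtain ⟨x, rfl⟩ := Φ.surjective h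
    obtain ⟨g, rfl⟩ := Ideal.Quotient.mk_surjective x
    -- An isomorphism fixing the variables is induced by `polyC`, so surjectivity would make `h` a
    -- polynomial.
    have : (Φ : RingC 2 ℤ →+* graphCohomology (typeC 2)).comp (Ideal.Quotient.mk (idealC 2 ℤ)) =
        (polyC 2 : MvPolynomial (Fin 2 ⊕ Fin 2) ℤ →+* _) := by
      apply MvPolynomial.ringHom_ext
      · intro r
        simp
      · rintro (i | i)
        · simpa [polyC] using h1 i
        · simpa [polyC] using h2 i
    have h3 : Φ (Ideal.Quotient.mk (idealC 2 ℤ) g) = polyC 2 g := DFunLike.congr_fun this g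
    rw [h3] at hh
    exact two_mul_polyC_ne g hh
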